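/- Let $\mathbb{D}=\{a+b\epsilon: a,b\in\mathbb{R}\}$ with $\epsilon^2=0$ be the dual numbers and let $\mathbb{DQ}=\{q_{st}+q_I\epsilon\}$, with $q_{st},q_I$ real quaternions and $\epsilon$ central, be the dual quaternions, with conjugation $(q_{st}+q_I\epsilon)^*=q_{st}^*+q_I^*\epsilon$; $M^*$ denotes the conjugate transpose of a matrix $M$ over $\mathbb{DQ}$, and a square matrix $U$ over $\mathbb{DQ}$ is unitary if $U^*U=UU^*=I$. A dual number $c$ is an eigenvalue of $A\in\mathbb{DQ}^{n\times n}$ if $A\mathbf{x}=\mathbf{x}c$ for some $\mathbf{x}\in\mathbb{DQ}^n$ having at least one component with nonzero standard part. **Theorem.** Let $B\in\mathbb{DQ}^{m\times n}$ and $A=B^*B$. Then there exists a unitary matrix $U\in\mathbb{DQ}^{n\times n}$ such that $$U^*AU=\mathrm{diag}(\lambda_1+\lambda_{1,1}\epsilon,\dots,\lambda_1+\lambda_{1,k_1}\epsilon,\ \lambda_2+\lambda_{2,1}\epsilon,\dots,\lambda_s+\lambda_{s,k_s}\epsilon,\ O),$$ where $s\ge 0$, $k_1,\dots,k_s\ge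 1$, $k_1+\cdots+k_s\le n$, $O$ is the zero matrix of the remaining size, and $\lambda_1>\cdots>\lambda_s>0$ and $\lambda_{i,1}\ge\cdots\ge\lambda_{i,k_i}$ ($i=1,\dots,s$) are real numbers. Counting multiplicities, these real numbers are uniquely determined by $B$: $s$, the $k_i$, the $\lambda_i$ and the $\lambda_{i,j}$ are the same for every unitary $U$ that brings $A$ to such a form. Moreover, every eigenvalue of $A$ with zero standard part is zero. -/

import Mathlib

open scoped Matrix Quaternion

noncomputable section

namespace DualQuat

/-- The dual quaternions: quaternions with coefficients in the real dual numbers. Mathlib's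
`Quaternion.dualNumberEquiv` identifies them with the elements `q_st + q_I ε`, where `q_st` and
`q_I` are real quaternions. Mathlib's `star` on this type is quaternion conjugation, which fixes
the central element `ε`, that is `star (q_st + q_I ε) = star q_st + (star q_I) ε`. -/
abbrev DQ : Type := Quaternion (DualNumber ℝ)

/-- The standard part `q_st` of a dual quaternion `q = q_st + q_I ε`. -/
def stdPart (q : DQ) : Quaternion ℝ := (Quaternion.dualNumberEquiv q).fst

/-- The dual number `a + b ε`. -/
def dual (a b : ℝ) : DualNumber ℝ := TrivSqZeroExt.inl a + b • DualNumber.eps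

/-- A dual quaternion vector is appreciable if some component has nonzero standard part. -/
def Appreciable {n : ℕ} (x : Fin n → DQ) : Prop := ∃ i, stdPart (x i) ≠ 0

/-- A dual number `c` is an eigenvalue of a square dual quaternion matrix `A` if `A x = x c` for
some appreciable vector `x`. -/
def IsEigenvalue {n : ℕ} (A : Matrix (Fin n) (Fin n) DQ) (c : DualNumber ℝ) : Prop :=
  ∃ x : Fin n → DQ, Appreciable x ∧ A *ᵥ x = fun i => x i * (c : DQ)

/-- A system of real numbers `λ_i` (`1 ≤ i ≤ s`) and `λ_{i,j}` (`1 ≤ j ≤ k_i`) is stored as the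
list of the `s` blocks `(λ_i, [λ_{i,1}, …, λ_{i,k_i}])`. It is admissible if all `k_i ≥ 1`,
`λ_1 > ⋯ > λ_s > 0`, and `λ_{i,1} ≥ ⋯ ≥ λ_{i,k_i}` for every `i`. -/
structure Admissible (L : List (ℝ × List ℝ)) : Prop where
  strictly_decreasing : (L.map Prod.fst).Pairwise (· > ·)
  pos : ∀ b ∈ L, 0 < b.1
  nonempty : ∀ b ∈ L, b.2 ≠ []
  decreasing : ∀ b ∈ L, b.2.Pairwise (· ≥ ·)

/-- The list `λ_1 + λ_{1,1} ε, …, λ_1 + λ_{1,k_1} ε, λ_2 + λ_{2,1} ε, …, λ_s + λ_{s,k_s} ε`. -/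
def entries (L : List (ℝ × List ℝ)) : List (DualNumber ℝ) :=
  L.flatMap fun b => b.2.map fun t => dual b.1 t

/-- The `n × n` diagonal matrix `diag(λ_1 + λ_{1,1} ε, …, λ_s + λ_{s,k_s} ε, O)`, padded by zeros
(meaningful when `k_1 + ⋯ + k_s ≤ n`). -/
def diagForm (n : ℕ) (L : List (ℝ × List ℝ)) : Matrix (Fin n) (Fin n) DQ :=
  Matrix.diagonal fun p => (((entries L).getD p 0 : DualNumber ℝ) : DQ)

end DualQuat

end

/-! A Hermitian matrix `S + T ε` over the dual quaternions is diagonalized one eigenvector at a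
time. Its eigenvalue equation splits by powers of `ε` into `S x = a x` and `S y + T x = a y + b x`,
problems of real linear algebra: compressing `T` to an eigenspace of `S` yields `x` and `b`, and the
Fredholm alternative yields `y`. A generalized reflection moves the normalized eigenvector to `e₀`,
and induction handles the remaining block.

For `A = Bᴴ * B`, an eigenpair satisfies `|Bx|² = |x|² c`, so `c` has nonnegative standard part. If
that part is zero, every component of `Bx` is a multiple of `ε`, so `|Bx|² = 0` and `c = 0`, since
`|x|²` is a unit.

Two diagonalizations are intertwined by a unitary `V`. The squared norms of the standard parts of
its entries form a doubly stochastic array supported where the diagonal entries agree, so the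
diagonals agree up to a permutation. Sorting lexicographically and dropping zeros recovers the
blocks. -/

noncomputable section

/-! ### First-order perturbation of symmetric operators -/

/-- For symmetric operators `S`, `T` on a real inner product space, the first order perturbation
`S + ε T` has an eigenvector `x + ε y` with eigenvalue `a + ε b`. -/
theorem LinearMap.IsSymmetric.exists_dual_eigenvector {V : Type*} [NormedAddCommGroup V]
    [InnerProductSpace ℝ V] [FiniteDimensional ℝ V] [Nontrivial V] {S T : V →ₗ[ℝ] V}
    (hS : S.IsSymmetric) (hT : T.IsSymmetric) :
    ∃ (a b : ℝ) (x y : V), x ≠ 0 ∧ S x = a • x ∧ S y + T x = a • y + b • x := by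
  obtain ⟨a, ha⟩ : ∃ a : ℝ, Module.End.HasEigenvalue S a :=
    ⟨_, hS.hasEigenvalue_iSup_of_finiteDimensional⟩
  let E : Submodule ℝ V := Module.End.eigenspace S a
  let P : V →ₗ[ℝ] E := E.orthogonalProjectionOnto.toLinearMap
  let T' : E →ₗ[ℝ] E := P ∘ₗ T ∘ₗ E.subtype
  have hT' : T'.IsSymmetric := by
    intro u v
    have h := hT u v
    change inner ℝ (P (T u)) v = inner ℝ u (P (T v))
    exact (Submodule.inner_orthogonalProjectionOnto_eq_of_mem_right v (T u)).trans
      (h.trans (Submodule.inner_orthogonalProjectionOnto_eq_of_mem_left u (T v)).symm)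
  have : Nontrivial E := by
    rw [Submodule.nontrivial_iff_ne_bot]
    exact ha
  obtain ⟨b, hb⟩ : ∃ b : ℝ, Module.End.HasEigenvalue T' b :=
    ⟨_, hT'.hasEigenvalue_iSup_of_finiteDimensional⟩
  obtain ⟨x, hx⟩ := hb.exists_hasEigenvector
  have hx1 : T' x = b • x := hx.apply_eq_smul
  have hSx : S x = a • (x : V) := Module.End.mem_eigenspace_iff.1 x.2
  have hR : (S - a • LinearMap.id).IsSymmetric := by
    intro u v
    simp [inner_sub_left, inner_sub_right, hS u v, real_inner_smul_left, real_inner_smul_right]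
  have hker : (LinearMap.range (S - a • LinearMap.id)).orthogonal = E := by
    rw [hR.orthogonal_range]
    ext v
    simp [E, sub_eq_zero]
  -- The equation `(S - a) y = b x - T x` is solvable exactly when its right side is orthogonal to
  -- `E`, which is how `b` and `x` were chosen.
  have hmem : b • (x : V) - T x ∈ LinearMap.range (S - a • LinearMap.id) := by
    rw [← Submodule.orthogonal_orthogonal (LinearMap.range (S - a • LinearMap.id)), hker,
      ← Submodule.orthogonalProjectionOnto_eq_zero_iff]
    rw [map_sub, map_smul, Submodule.orthogonalProjectionOnto_mem_subspace_eq_self, ← hx1, sub_eq_zero]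
    rfl
  obtain ⟨y, hy⟩ := hmem
  refine ⟨a, b, x, y, by simpa using hx.2, hSx, ?_⟩
  simp only [LinearMap.sub_apply, LinearMap.smul_apply, LinearMap.id_apply] at hy
  rw [sub_eq_iff_eq_add] at hy
  rw [hy]; abel

/-! ### Reflections and deflation over star rings -/

/-- If `X` and `Y` have orthonormal columns and `1 - Yᴴ X` is invertible, then some unitary matrix,
a generalized reflection, maps `X` to `Y`. -/
theorem Matrix.exists_unitary_mul_eq {R m k : Type*} [Ring R] [StarRing R] [Fintype m]
    [DecidableEq m] [Fintype k] [DecidableEq k] {X Y : Matrix m k R} (hX : Xᴴ * X = 1)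
    (hY : Yᴴ * Y = 1) (h : IsUnit (1 - Yᴴ * X)) :
    ∃ U ∈ unitary (Matrix m m R), U * X = Y := by
  obtain ⟨⟨b, a, hba, hab⟩, hb⟩ := h
  simp only at hb
  have hVX : (X - Y)ᴴ * X = b := by
    rw [Matrix.conjTranspose_sub, Matrix.sub_mul, hX, hb]
  have hVV : (X - Y)ᴴ * (X - Y) = b + bᴴ := by
    rw [hb]
    simp only [Matrix.conjTranspose_sub, Matrix.sub_mul, Matrix.mul_sub, hX, hY,
      Matrix.conjTranspose_mul, Matrix.conjTranspose_conjTranspose, Matrix.conjTranspose_one]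
    abel
  generalize hV : X - Y = V at hVX hVV
  have hab' : aᴴ * bᴴ = 1 := by rw [← Matrix.conjTranspose_mul, hba, Matrix.conjTranspose_one]
  have hba' : bᴴ * aᴴ = 1 := by rw [← Matrix.conjTranspose_mul, hab, Matrix.conjTranspose_one]
  have h1 : a * (b + bᴴ) * aᴴ = a + aᴴ := by
    rw [mul_add, add_mul, hab, one_mul, mul_assoc, hba', mul_one, add_comm]
  have h2 : aᴴ * (b + bᴴ) * a = a + aᴴ := by
    rw [mul_add, add_mul, hab', one_mul, mul_assoc, hba, mul_one, add_comm]
  have key : ∀ p q : Matrix k k R, (1 - V * p * Vᴴ) * (1 - V * q * Vᴴ)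
      = 1 - V * (p + q - p * (b + bᴴ) * q) * Vᴴ := by
    intro p q
    rw [← hVV]
    simp only [Matrix.sub_mul, Matrix.mul_sub, Matrix.mul_add, Matrix.add_mul, Matrix.mul_assoc,
      Matrix.one_mul, Matrix.mul_one]
    abel
  have hstar : (1 - V * a * Vᴴ)ᴴ = 1 - V * aᴴ * Vᴴ := by
    simp [Matrix.conjTranspose_sub, Matrix.conjTranspose_mul, Matrix.mul_assoc]
  -- With `V = X - Y` and `a = (1 - Yᴴ X)⁻¹`, the identity `Vᴴ X = a⁻¹` gives `U X = X - V = Y`.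
  -- Unitarity is `h1` and `h2`, which cancel the middle factor in `key`.
  refine ⟨1 - V * a * Vᴴ, ?_, ?_⟩
  · rw [Unitary.mem_iff, Matrix.star_eq_conjTranspose, hstar, key, key, h1, h2]
    simp [add_comm]
  · rw [Matrix.sub_mul, Matrix.mul_assoc, Matrix.mul_assoc, hVX, hab, ← hV]
    simp

/-- Bordering a diagonalization: if the first column of the Hermitian matrix `A` is `c e₀`, then a
unitary diagonalization of the remaining block extends to one of `A`. -/
theorem Matrix.IsHermitian.exists_diagonal_of_submatrix {R : Type*} [Ring R] [StarRing R] {n : ℕ}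
    {A : Matrix (Fin (n + 1)) (Fin (n + 1)) R} (hA : A.IsHermitian)
    (h0 : ∀ i : Fin n, A i.succ 0 = 0) {W : Matrix (Fin n) (Fin n) R}
    (hW : W ∈ unitary (Matrix (Fin n) (Fin n) R)) {d : Fin n → R}
    (hd : Wᴴ * A.submatrix Fin.succ Fin.succ * W = Matrix.diagonal d) :
    ∃ U ∈ unitary (Matrix (Fin (n + 1)) (Fin (n + 1)) R),
      Uᴴ * A * U = Matrix.diagonal (Fin.cons (A 0 0) d : Fin (n + 1) → R) := by
  have h0' : ∀ i : Fin n, A 0 i.succ = 0 := fun i => by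
    rw [← hA.apply, h0, star_zero]
  let U : Matrix (Fin (n + 1)) (Fin (n + 1)) R := Matrix.of
    (Fin.cons (Fin.cons 1 0) fun i => Fin.cons 0 (W i))
  have hW' := Unitary.mem_iff.1 hW
  have e1 : ∀ i j, ∑ k, star (W k i) * W k j = (1 : Matrix (Fin n) (Fin n) R) i j := by
    intro i j
    rw [← hW'.1]; rfl
  have e2 : ∀ i j, ∑ k, W i k * star (W j k) = (1 : Matrix (Fin n) (Fin n) R) i j := by
    intro i j
    rw [← hW'.2]; rfl
  refine ⟨U, ?_, ?_⟩
  · rw [Unitary.mem_iff]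
    constructor
    · ext i j
      refine Fin.cases ?_ (fun i => ?_) i <;> refine Fin.cases ?_ (fun j => ?_) j <;>
        simp [U, Matrix.mul_apply, Fin.sum_univ_succ, Matrix.one_apply, e1, Fin.succ_ne_zero,
          (Fin.succ_ne_zero _).symm]
    · ext i j
      refine Fin.cases ?_ (fun i => ?_) i <;> refine Fin.cases ?_ (fun j => ?_) j <;>
        simp [U, Matrix.mul_apply, Fin.sum_univ_succ, Matrix.one_apply, e2, Fin.succ_ne_zero,
          (Fin.succ_ne_zero _).symm]
  · have e3 : ∀ i j, ∑ k, (∑ l, star (W l i) * A l.succ k.succ) * W k j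
        = Matrix.diagonal d i j := by
      intro i j
      rw [← hd]; rfl
    ext i j
    refine Fin.cases ?_ (fun i => ?_) i <;> refine Fin.cases ?_ (fun j => ?_) j <;>
      simp [U, Matrix.mul_apply, Fin.sum_univ_succ, h0, h0', e3, Fin.succ_ne_zero,
          (Fin.succ_ne_zero _).symm, Matrix.diagonal_apply]

/-- Deflation: a unit eigenvector reduces the unitary diagonalization of a Hermitian matrix to one
size less. The predicate `P` restricts the diagonal entries. -/
theorem Matrix.IsHermitian.exists_unitary_diagonal_succ {R : Type*} [Ring R] [StarRing R] {n : ℕ}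
    {P : R → Prop} (ih : ∀ A : Matrix (Fin n) (Fin n) R, A.IsHermitian →
      ∃ W ∈ unitary (Matrix (Fin n) (Fin n) R), ∃ d : Fin n → R, (∀ i, P (d i)) ∧
        Wᴴ * A * W = Matrix.diagonal d)
    {A : Matrix (Fin (n + 1)) (Fin (n + 1)) R} (hA : A.IsHermitian)
    {X : Matrix (Fin (n + 1)) (Fin 1) R} (hX : Xᴴ * X = 1) (hu : IsUnit (1 - X 0 0)) {c : R}
    (hc : P c) (hAX : ∀ i, (A * X) i 0 = X i 0 * c) :
    ∃ U ∈ unitary (Matrix (Fin (n + 1)) (Fin (n + 1)) R), ∃ d : Fin (n + 1) → R,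
      (∀ i, P (d i)) ∧ Uᴴ * A * U = Matrix.diagonal d := by
  -- `Y` is the column `e₀`, so `Yᴴ * X` is the single entry `X 0 0`.
  let Y : Matrix (Fin (n + 1)) (Fin 1) R := Matrix.of fun i _ => if i = 0 then 1 else 0
  have hY : Yᴴ * Y = 1 := by
    ext i j
    rw [Subsingleton.elim i j]
    simp [Y, Matrix.mul_apply]
  have hu' : IsUnit (1 - Yᴴ * X) := by
    have e : 1 - Yᴴ * X = Matrix.scalar (Fin 1) (1 - X 0 0) := by
      ext i j
      rw [Subsingleton.elim i 0, Subsingleton.elim j 0]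
      simp [Y, Matrix.mul_apply, Fin.sum_univ_succ]
    rw [e]
    exact hu.map _
  obtain ⟨Q, hQ, hQX⟩ := Matrix.exists_unitary_mul_eq hX hY hu'
  have hQ' := Unitary.mem_iff.1 hQ
  rw [Matrix.star_eq_conjTranspose] at hQ'
  have hA' : (Q * A * Qᴴ).IsHermitian := by
    simp [Matrix.IsHermitian, Matrix.conjTranspose_mul, hA.eq, Matrix.mul_assoc]
  have hcol : ∀ i, (Q * A * Qᴴ) i 0 = if i = 0 then c else 0 := by
    have e : Q * A * Qᴴ * Y = Q * (A * X) := by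
      rw [← hQX, Matrix.mul_assoc _ Qᴴ, ← Matrix.mul_assoc Qᴴ, hQ'.1, Matrix.one_mul,
        Matrix.mul_assoc]
    intro i
    have e1 : (Q * A * Qᴴ * Y) i 0 = (Q * A * Qᴴ) i 0 := by
      rw [Matrix.mul_apply]
      simp [Y]
    rw [← e1, e, Matrix.mul_apply]
    simp only [hAX, ← mul_assoc]
    rw [← Finset.sum_mul, ← Matrix.mul_apply, hQX]
    simp [Y]
  obtain ⟨W, hW, d, hP, hd⟩ := ih _ (hA'.submatrix Fin.succ)
  obtain ⟨U, hU, hd'⟩ := hA'.exists_diagonal_of_submatrix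
    (fun i => by rw [hcol, if_neg (Fin.succ_ne_zero i)]) hW hd
  refine ⟨Qᴴ * U, mul_mem (Unitary.star_mem hQ) hU, Fin.cons c d, Fin.cases hc hP, ?_⟩
  rw [Matrix.conjTranspose_mul, Matrix.conjTranspose_conjTranspose]
  have : Uᴴ * Q * A * (Qᴴ * U) = Uᴴ * (Q * A * Qᴴ) * U := by
    simp only [Matrix.mul_assoc]
  rw [this, hd', hcol, if_pos rfl]

/-! ### Quaternion vectors and their norms -/

theorem Quaternion.sum_star_mul_self {R ι : Type*} [CommRing R] [Fintype ι] (x : ι → ℍ[R]) :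
    ∑ i, star (x i) * x i = ((∑ i, Quaternion.normSq (x i) : R) : ℍ[R]) := by
  simp only [Quaternion.star_mul_self]
  exact (map_sum (algebraMap R ℍ[R]) _ _).symm

theorem Quaternion.conjTranspose_mul_self_of_smul {R ι : Type*} [CommRing R] [Fintype ι]
    {x : ι → ℍ[R]} {s : R} (hs : s * s * ∑ i, Quaternion.normSq (x i) = 1) :
    (Matrix.of fun i (_ : Fin 1) => x i * (s : ℍ[R]))ᴴ
      * (Matrix.of fun i (_ : Fin 1) => x i * (s : ℍ[R])) = 1 := by
  ext1 i j
  rw [Subsingleton.elim i j, Matrix.one_apply_eq, Matrix.mul_apply]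
  simp only [Matrix.conjTranspose_apply, Matrix.of_apply, star_mul, Quaternion.star_coe]
  have : ∀ k, (s : ℍ[R]) * star (x k) * (x k * (s : ℍ[R]))
      = ((s * s : R) : ℍ[R]) * (star (x k) * x k) := fun k => by
    rw [Quaternion.coe_mul, mul_assoc, mul_assoc, ← mul_assoc (star (x k)),
      ← Quaternion.coe_commutes]
  simp only [this]
  rw [← Finset.mul_sum, Quaternion.sum_star_mul_self, ← Quaternion.coe_mul, hs, Quaternion.coe_one]

theorem Quaternion.mul_smul_apply {R ι : Type*} [CommRing R] [Fintype ι] {A : Matrix ι ι ℍ[R]}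
    {x : ι → ℍ[R]} {c : R} (h : A *ᵥ x = fun i => x i * (c : ℍ[R])) (s : R) (i : ι) :
    (A * Matrix.of fun i (_ : Fin 1) => x i * (s : ℍ[R])) i 0
      = x i * (s : ℍ[R]) * (c : ℍ[R]) := by
  have := congrFun h i
  simp only [Matrix.mulVec, dotProduct] at this
  simp only [Matrix.mul_apply, Matrix.of_apply, ← mul_assoc]
  rw [← Finset.sum_mul, this, mul_assoc, mul_assoc, Quaternion.coe_commutes]

/-- Evaluates `xᴴ Bᴴ B x` in two ways. Both the sign of the eigenvalues and the vanishing of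
infinitesimal ones come from this identity. -/
theorem Quaternion.sum_normSq_mulVec {R ι κ : Type*} [CommRing R] [Fintype ι] [Fintype κ]
    {B : Matrix κ ι ℍ[R]} {x : ι → ℍ[R]} {c : R}
    (h : (Bᴴ * B) *ᵥ x = fun i => x i * (c : ℍ[R])) :
    ∑ i, Quaternion.normSq ((B *ᵥ x) i) = (∑ i, Quaternion.normSq (x i)) * c := by
  apply Quaternion.coe_injective
  rw [Quaternion.coe_mul, ← sum_star_mul_self, ← sum_star_mul_self]
  have e : star (B *ᵥ x) ⬝ᵥ (B *ᵥ x) = star x ⬝ᵥ ((Bᴴ * B) *ᵥ x) := by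
    rw [Matrix.star_mulVec, ← Matrix.dotProduct_mulVec, Matrix.mulVec_mulVec]
  rw [h] at e
  simp only [dotProduct, Pi.star_apply] at e
  rw [e, Finset.sum_mul]
  simp only [mul_assoc]

theorem Quaternion.sum_normSq_col {R ι : Type*} [CommRing R] [Fintype ι] [DecidableEq ι]
    {U : Matrix ι ι ℍ[R]} (hU : Uᴴ * U = 1) (j : ι) : ∑ i, Quaternion.normSq (U i j) = 1 := by
  apply Quaternion.coe_injective
  rw [← sum_star_mul_self, Quaternion.coe_one, ← Matrix.one_apply_eq j, ← hU]
  rfl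

/-! ### Spectral theorem over the dual quaternions -/

namespace DualQuat

/-- The dual part `q_I` of a dual quaternion `q = q_st + q_I ε`. -/
def dualPart (q : DQ) : Quaternion ℝ := (Quaternion.dualNumberEquiv q).snd

theorem dq_ext {p q : DQ} (h₁ : stdPart p = stdPart q) (h₂ : dualPart p = dualPart q) : p = q :=
  Quaternion.dualNumberEquiv.injective (TrivSqZeroExt.ext h₁ h₂)

/-- The standard part as a ring homomorphism. -/
def stdHom : DQ →+* Quaternion ℝ :=
  (TrivSqZeroExt.fstHom ℝ (Quaternion ℝ) (Quaternion ℝ)).toRingHom.comp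
    (Quaternion.dualNumberEquiv : DQ ≃ₐ[ℝ] _).toRingEquiv.toRingHom

/-- The dual part as an additive homomorphism. -/
def dualHom : DQ →+ Quaternion ℝ where
  toFun := dualPart
  map_zero' := rfl
  map_add' _ _ := rfl

theorem stdPart_mul (p q : DQ) : stdPart (p * q) = stdPart p * stdPart q :=
  map_mul stdHom p q

theorem dualPart_mul (p q : DQ) :
    dualPart (p * q) = stdPart p * dualPart q + dualPart p * stdPart q := by
  simp [dualPart, stdPart]

theorem stdPart_star (q : DQ) : stdPart (star q) = star (stdPart q) := by
  ext <;> simp [stdPart]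

theorem dualPart_star (q : DQ) : dualPart (star q) = star (dualPart q) := by
  ext <;> simp [dualPart]

theorem stdPart_coe (c : DualNumber ℝ) : stdPart (c : DQ) = (c.fst : Quaternion ℝ) := by
  ext <;> simp [stdPart]

theorem dualPart_coe (c : DualNumber ℝ) : dualPart (c : DQ) = (c.snd : Quaternion ℝ) := by
  ext <;> simp [dualPart]

theorem stdPart_sum {ι : Type*} (s : Finset ι) (f : ι → DQ) :
    stdPart (∑ i ∈ s, f i) = ∑ i ∈ s, stdPart (f i) := map_sum stdHom f s

theorem dualPart_sum {ι : Type*} (s : Finset ι) (f : ι → DQ) :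
    dualPart (∑ i ∈ s, f i) = ∑ i ∈ s, dualPart (f i) := map_sum dualHom f s

@[simp] theorem dual_fst (a b : ℝ) : (dual a b).fst = a := by simp [dual]

@[simp] theorem dual_snd (a b : ℝ) : (dual a b).snd = b := by simp [dual]

/-- The dual part is nilpotent and the real quaternions form a division ring. -/
theorem isUnit_iff_stdPart_ne_zero {q : DQ} : IsUnit q ↔ stdPart q ≠ 0 := by
  rw [← isUnit_iff_ne_zero, stdPart, ← TrivSqZeroExt.isUnit_iff_isUnit_fst]
  exact (MulEquiv.isUnit_map (Quaternion.dualNumberEquiv : DQ ≃ₐ[ℝ] _)).symm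

theorem normSq_fst (q : DQ) : (Quaternion.normSq q).fst = Quaternion.normSq (stdPart q) := by
  simp only [Quaternion.normSq_def']
  simp [stdPart, pow_two]

/-- A dual number with positive standard part has an inverse square root. -/
theorem exists_sq_mul_eq_one {N : DualNumber ℝ} (hN : 0 < N.fst) :
    ∃ r : DualNumber ℝ, r * r * N = 1 := by
  obtain ⟨s, hs, hs2⟩ : ∃ s : ℝ, s ≠ 0 ∧ s * s = N.fst :=
    ⟨√N.fst, (Real.sqrt_pos.2 hN).ne', Real.mul_self_sqrt hN.le⟩
  -- First-order Taylor expansion of `N ^ (-1/2)` at `s²`.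
  refine ⟨dual s⁻¹ (-N.snd / (2 * s ^ 3)), ?_⟩
  ext
  · simp [← hs2]; field_simp
  · simp [← hs2]; field_simp; ring

/-- The `ℝ`-linear operator `x ↦ M x` on the Euclidean space of quaternion vectors. -/
def mulVecLin {n : ℕ} (M : Matrix (Fin n) (Fin n) (Quaternion ℝ)) :
    PiLp 2 (fun _ : Fin n => Quaternion ℝ) →ₗ[ℝ] PiLp 2 (fun _ : Fin n => Quaternion ℝ) where
  toFun x := WithLp.toLp 2 (M *ᵥ x.ofLp)
  map_add' x y := by simp [Matrix.mulVec_add]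
  map_smul' a x := by simp [Matrix.mulVec_smul]

theorem mulVecLin_apply {n : ℕ} (M : Matrix (Fin n) (Fin n) (Quaternion ℝ))
    (x : PiLp 2 (fun _ : Fin n => Quaternion ℝ)) (i : Fin n) :
    mulVecLin M x i = ∑ j, M i j * x j := rfl

/-- The inner product is the real part of `p * star q`, while `M` acts from the left; cyclicity of
the real part moves `M` across. -/
theorem mulVecLin_isSymmetric {n : ℕ} {M : Matrix (Fin n) (Fin n) (Quaternion ℝ)}
    (hM : M.IsHermitian) : (mulVecLin M).IsSymmetric := by
  have re_comm : ∀ p q : Quaternion ℝ, (p * q).re = (q * p).re := fun p q => by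
    simp only [Quaternion.re_mul]; ring
  have re_sum : ∀ f : Fin n → Quaternion ℝ, (∑ i, f i).re = ∑ i, (f i).re := fun f =>
    map_sum (⟨⟨fun q => q.re, rfl⟩, fun _ _ => rfl⟩ : Quaternion ℝ →+ ℝ) f _
  intro x y
  simp only [PiLp.inner_apply, Quaternion.inner_def, mulVecLin_apply, star_sum, Finset.sum_mul,
    Finset.mul_sum, re_sum]
  rw [Finset.sum_comm]
  refine Finset.sum_congr rfl fun j _ => Finset.sum_congr rfl fun i _ => ?_
  rw [star_mul, hM.apply, ← mul_assoc (x j), re_comm (x j * star (y i)), mul_assoc]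

theorem exists_isEigenvalue {n : ℕ} [NeZero n]
    {A : Matrix (Fin n) (Fin n) DQ} (hA : A.IsHermitian) : ∃ c, IsEigenvalue A c := by
  have hs : (A.map stdPart).IsHermitian := Matrix.ext fun i j =>
    (stdPart_star _).symm.trans (congrArg stdPart (hA.apply i j))
  have ht : (A.map dualPart).IsHermitian := Matrix.ext fun i j =>
    (dualPart_star _).symm.trans (congrArg dualPart (hA.apply i j))
  obtain ⟨a, b, x, y, hx, h₁, h₂⟩ :=
    (mulVecLin_isSymmetric hs).exists_dual_eigenvector (mulVecLin_isSymmetric ht)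
  let z : Fin n → DQ := fun i =>
    Quaternion.dualNumberEquiv.symm (TrivSqZeroExt.inl (x i) + TrivSqZeroExt.inr (y i))
  have zs : ∀ i, stdPart (z i) = x i := fun i => by simp [z, stdPart]
  have zt : ∀ i, dualPart (z i) = y i := fun i => by simp [z, dualPart]
  refine ⟨dual a b, z, ?_, ?_⟩
  · by_contra h
    apply hx
    ext1 i
    by_contra hi
    exact h ⟨i, by rwa [zs]⟩
  · funext i
    have e₁ := congrArg (fun v => v i) h₁
    have e₂ := congrArg (fun v => v i) h₂
    simp only [PiLp.add_apply, PiLp.smul_apply, mulVecLin_apply, Matrix.map_apply] at e₁ e₂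
    apply dq_ext
    · simp only [Matrix.mulVec, dotProduct, stdPart_sum, stdPart_mul, stdPart_coe, zs, e₁, dual_fst]
      rw [Quaternion.mul_coe_eq_smul]
    · simp only [Matrix.mulVec, dotProduct, dualPart_sum, dualPart_mul, stdPart_coe, dualPart_coe,
        zs, zt, dual_fst, dual_snd, Finset.sum_add_distrib, e₂]
      rw [Quaternion.mul_coe_eq_smul, Quaternion.mul_coe_eq_smul, add_comm]

theorem sum_normSq_fst {n : ℕ} (x : Fin n → DQ) :
    (∑ i, Quaternion.normSq (x i)).fst = ∑ i, Quaternion.normSq (stdPart (x i)) := by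
  simp only [← normSq_fst]
  exact map_sum (TrivSqZeroExt.fstHom ℝ ℝ ℝ) _ _

theorem Appreciable.sum_normSq_fst_pos {n : ℕ} {x : Fin n → DQ} (hx : Appreciable x) :
    0 < (∑ i, Quaternion.normSq (x i)).fst := by
  rw [sum_normSq_fst]
  obtain ⟨i, hi⟩ := hx
  exact Finset.sum_pos' (fun _ _ => Quaternion.normSq_nonneg)
    ⟨i, Finset.mem_univ _, lt_of_le_of_ne Quaternion.normSq_nonneg
      (Ne.symm (Quaternion.normSq_ne_zero.2 hi))⟩

/-- An eigenvalue has a unit eigenvector whose first component has standard part other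
than `1`. -/
theorem IsEigenvalue.exists_unit {n : ℕ} {A : Matrix (Fin (n + 1)) (Fin (n + 1)) DQ}
    {c : DualNumber ℝ} (h : IsEigenvalue A c) :
    ∃ X : Matrix (Fin (n + 1)) (Fin 1) DQ, Xᴴ * X = 1 ∧ stdPart (X 0 0) ≠ 1 ∧
      ∀ i, (A * X) i 0 = X i 0 * (c : DQ) := by
  obtain ⟨x, hx, hAx⟩ := h
  obtain ⟨r, hr⟩ := exists_sq_mul_eq_one hx.sum_normSq_fst_pos
  -- The reflection needs `1 - X 0 0` invertible. If the standard part is `1`, negating the vector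
  -- makes it `-1`.
  by_cases h1 : stdPart (x 0 * (r : DQ)) = 1
  · refine ⟨_, Quaternion.conjTranspose_mul_self_of_smul (s := -r) (by rwa [neg_mul_neg]), ?_,
      Quaternion.mul_smul_apply hAx (-r)⟩
    rw [stdPart_mul, stdPart_coe] at h1
    simp only [Matrix.of_apply]
    rw [stdPart_mul, stdPart_coe, TrivSqZeroExt.fst_neg, Quaternion.coe_neg, mul_neg, h1]
    intro h
    have : (-1 : ℝ) = 1 := congrArg (fun q : Quaternion ℝ => q.re) h
    norm_num at this
  · exact ⟨_, Quaternion.conjTranspose_mul_self_of_smul hr, h1, Quaternion.mul_smul_apply hAx r⟩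

/-- Spectral theorem for Hermitian dual quaternion matrices. -/
theorem exists_unitary_diagonal {n : ℕ} {A : Matrix (Fin n) (Fin n) DQ}
    (hA : A.IsHermitian) :
    ∃ U ∈ unitary (Matrix (Fin n) (Fin n) DQ), ∃ d : Fin n → DualNumber ℝ,
      Uᴴ * A * U = Matrix.diagonal fun i => (d i : DQ) := by
  have key : ∃ U ∈ unitary (Matrix (Fin n) (Fin n) DQ), ∃ d : Fin n → DQ,
      (∀ i, ∃ c : DualNumber ℝ, (c : DQ) = d i) ∧ Uᴴ * A * U = Matrix.diagonal d := by
    induction n with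
    | zero => exact ⟨1, one_mem _, 0, fun i => i.elim0, Subsingleton.elim _ _⟩
    | succ n ih =>
      obtain ⟨c, hc⟩ := exists_isEigenvalue hA
      obtain ⟨X, hX, hX0, hAX⟩ := hc.exists_unit
      have hu : IsUnit (1 - X 0 0) := isUnit_iff_stdPart_ne_zero.2 fun h =>
        hX0 (sub_eq_zero.1 ((map_sub stdHom 1 (X 0 0)).symm.trans h)).symm
      have ih' : ∀ A : Matrix (Fin n) (Fin n) DQ, A.IsHermitian → _ := fun A hA => ih hA
      exact Matrix.IsHermitian.exists_unitary_diagonal_succ (R := DQ)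
        (P := fun q => ∃ c : DualNumber ℝ, (c : DQ) = q) ih' hA hX hu ⟨c, rfl⟩ hAX
  obtain ⟨U, hU, d, hd, h⟩ := key
  choose d' hd' using hd
  exact ⟨U, hU, d', by rw [h, funext hd']⟩

end DualQuat

/-! ### Uniqueness of the diagonal and eigenvalues of Gram matrices -/

/-- If a doubly stochastic array is supported on pairs where `g i = f j`, then `f` and `g` agree up
to a permutation. -/
theorem exists_perm_of_doubly_stochastic {ι γ : Type*} [Fintype ι] {f g : ι → γ}
    {a : ι → ι → ℝ} (hcol : ∀ j, ∑ i, a i j = 1) (hrow : ∀ i, ∑ j, a i j = 1)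
    (h : ∀ i j, a i j ≠ 0 → g i = f j) : ∃ σ : Equiv.Perm ι, ∀ j, g (σ j) = f j := by
  classical
  -- Both fibres over `c` have size equal to the sum of `a` over their product: columns and rows sum
  -- to `1` and vanish outside it.
  have hcard : ∀ c, Fintype.card {j // f j = c} = Fintype.card {i // g i = c} := by
    intro c
    simp only [Fintype.card_subtype]
    have e₁ : ((Finset.univ.filter fun j => f j = c).card : ℝ)
        = ∑ j ∈ Finset.univ.filter fun j => f j = c,
          ∑ i ∈ Finset.univ.filter fun i => g i = c, a i j := by
      rw [Finset.card_eq_sum_ones, Nat.cast_sum]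
      refine Finset.sum_congr rfl fun j hj => ?_
      rw [Nat.cast_one, ← hcol j]
      symm
      refine Finset.sum_subset (Finset.subset_univ _) fun i _ hi => ?_
      by_contra h0
      simp only [Finset.mem_filter, Finset.mem_univ, true_and] at hi hj
      exact hi ((h i j h0).trans hj)
    have e₂ : ((Finset.univ.filter fun i => g i = c).card : ℝ)
        = ∑ i ∈ Finset.univ.filter fun i => g i = c,
          ∑ j ∈ Finset.univ.filter fun j => f j = c, a i j := by
      rw [Finset.card_eq_sum_ones, Nat.cast_sum]
      refine Finset.sum_congr rfl fun i hi => ?_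
      rw [Nat.cast_one, ← hrow i]
      symm
      refine Finset.sum_subset (Finset.subset_univ _) fun j _ hj => ?_
      by_contra h0
      simp only [Finset.mem_filter, Finset.mem_univ, true_and] at hi hj
      exact hj ((h i j h0).symm.trans hi)
    rw [Finset.sum_comm, ← e₁] at e₂
    exact_mod_cast e₂.symm
  exact ⟨Equiv.ofFiberEquiv fun c => Fintype.equivOfCardEq (hcard c),
    fun j => Equiv.ofFiberEquiv_map _ j⟩

theorem Matrix.exists_unitary_diagonal_comp {R m : Type*} [Ring R] [StarRing R] [Fintype m]
    [DecidableEq m] {A U : Matrix m m R} (hU : U ∈ unitary (Matrix m m R)) {d : m → R}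
    (hd : Uᴴ * A * U = Matrix.diagonal d) (σ : Equiv.Perm m) :
    ∃ U' ∈ unitary (Matrix m m R), U'ᴴ * A * U' = Matrix.diagonal (d ∘ σ) := by
  have hU' := Unitary.mem_iff.1 hU
  rw [Matrix.star_eq_conjTranspose] at hU'
  have e : (U.submatrix id σ)ᴴ = Uᴴ.submatrix σ id := rfl
  refine ⟨U.submatrix id σ, ?_, ?_⟩
  · rw [Unitary.mem_iff, Matrix.star_eq_conjTranspose, e]
    constructor
    · rw [← Matrix.submatrix_mul _ _ σ id σ Function.bijective_id, hU'.1]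
      exact Matrix.submatrix_one_equiv σ
    · rw [Matrix.submatrix_mul_equiv, hU'.2]
      rfl
  · rw [e, ← Matrix.submatrix_diagonal_equiv, ← hd]
    ext i j
    simp [Matrix.mul_apply]

theorem Matrix.mul_eq_mul_of_conjTranspose_mul_mul {R m : Type*} [Ring R] [StarRing R] [Fintype m]
    [DecidableEq m] {A U D : Matrix m m R} (hU : U ∈ unitary (Matrix m m R))
    (hd : Uᴴ * A * U = D) : A * U = U * D := by
  have hU' := (Unitary.mem_iff.1 hU).2
  rw [Matrix.star_eq_conjTranspose] at hU'
  rw [← hd, Matrix.mul_assoc, ← Matrix.mul_assoc U, hU', Matrix.one_mul]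

theorem Matrix.conjTranspose_mul_intertwines {R m : Type*} [Ring R] [StarRing R] [Fintype m]
    [DecidableEq m] {A U U' D D' : Matrix m m R} (hU : U ∈ unitary (Matrix m m R))
    (hU' : U' ∈ unitary (Matrix m m R)) (hd : Uᴴ * A * U = D) (hd' : U'ᴴ * A * U' = D') :
    U'ᴴ * U * D = D' * (U'ᴴ * U) := by
  have h := (Unitary.mem_iff.1 hU').2
  rw [Matrix.star_eq_conjTranspose] at h
  rw [Matrix.mul_assoc, ← Matrix.mul_eq_mul_of_conjTranspose_mul_mul hU hd, ← hd',
    Matrix.mul_assoc _ U', ← Matrix.mul_assoc U', h, Matrix.one_mul, Matrix.mul_assoc]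

namespace DualQuat

/-- The norm is quadratic in components that are all multiples of `ε`, and `ε² = 0`. -/
theorem normSq_eq_zero_of_stdPart {q : DQ} (h : stdPart q = 0) : Quaternion.normSq q = 0 := by
  have h₁ := congrArg (fun r : Quaternion ℝ => r.re) h
  have h₂ := congrArg (fun r : Quaternion ℝ => r.imI) h
  have h₃ := congrArg (fun r : Quaternion ℝ => r.imJ) h
  have h₄ := congrArg (fun r : Quaternion ℝ => r.imK) h
  simp only [stdPart, Quaternion.re_fst_dualNumberEquiv, Quaternion.imI_fst_dualNumberEquiv,
    Quaternion.imJ_fst_dualNumberEquiv, Quaternion.imK_fst_dualNumberEquiv, Quaternion.re_zero,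
    Quaternion.imI_zero, Quaternion.imJ_zero, Quaternion.imK_zero] at h₁ h₂ h₃ h₄
  rw [Quaternion.normSq_def']
  ext <;> simp [pow_two, h₁, h₂, h₃, h₄]

theorem IsEigenvalue.fst_nonneg {m n : ℕ} {B : Matrix (Fin m) (Fin n) DQ} {c : DualNumber ℝ}
    (h : IsEigenvalue (Bᴴ * B) c) : 0 ≤ c.fst := by
  obtain ⟨x, hx, hAx⟩ := h
  have e := congrArg TrivSqZeroExt.fst (Quaternion.sum_normSq_mulVec hAx)
  rw [TrivSqZeroExt.fst_mul, sum_normSq_fst] at e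
  have : 0 ≤ (∑ i, Quaternion.normSq (x i)).fst * c.fst := by
    rw [← e]
    exact Finset.sum_nonneg fun _ _ => Quaternion.normSq_nonneg
  exact nonneg_of_mul_nonneg_right this hx.sum_normSq_fst_pos

theorem IsEigenvalue.eq_zero {m n : ℕ} {B : Matrix (Fin m) (Fin n) DQ} {c : DualNumber ℝ}
    (h : IsEigenvalue (Bᴴ * B) c) (hc : c.fst = 0) : c = 0 := by
  obtain ⟨x, hx, hAx⟩ := h
  have e := Quaternion.sum_normSq_mulVec hAx
  have e₁ := congrArg TrivSqZeroExt.fst e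
  rw [TrivSqZeroExt.fst_mul, sum_normSq_fst, hc, mul_zero,
    Finset.sum_eq_zero_iff_of_nonneg fun _ _ => Quaternion.normSq_nonneg] at e₁
  rw [Finset.sum_eq_zero fun i hi => normSq_eq_zero_of_stdPart
    (Quaternion.normSq_eq_zero.1 (e₁ i hi))] at e
  have hu : IsUnit (∑ i, Quaternion.normSq (x i)) :=
    TrivSqZeroExt.isUnit_iff_isUnit_fst.2 (isUnit_iff_ne_zero.2 hx.sum_normSq_fst_pos.ne')
  exact (hu.mul_right_eq_zero).1 e.symm

theorem sum_normSq_stdPart_col {n : ℕ} {U : Matrix (Fin n) (Fin n) DQ} (hU : Uᴴ * U = 1)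
    (j : Fin n) : ∑ i, Quaternion.normSq (stdPart (U i j)) = 1 := by
  rw [← sum_normSq_fst fun i => U i j]
  exact congrArg TrivSqZeroExt.fst (Quaternion.sum_normSq_col hU j)

theorem isEigenvalue_of_diagonal {n : ℕ} {A U : Matrix (Fin n) (Fin n) DQ}
    (hU : U ∈ unitary (Matrix (Fin n) (Fin n) DQ)) {d : Fin n → DualNumber ℝ}
    (hd : Uᴴ * A * U = Matrix.diagonal fun i => (d i : DQ)) (j : Fin n) :
    IsEigenvalue A (d j) := by
  have hU' := Unitary.mem_iff.1 hU
  rw [Matrix.star_eq_conjTranspose] at hU'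
  refine ⟨fun i => U i j, ?_, ?_⟩
  · by_contra h
    simp only [Appreciable, not_exists, not_not] at h
    simpa [h] using sum_normSq_stdPart_col hU'.1 j
  · have e := Matrix.mul_eq_mul_of_conjTranspose_mul_mul hU hd
    funext i
    have := congrFun (congrFun e i) j
    rwa [Matrix.mul_diagonal] at this

/-- The diagonal of a unitary diagonalization is unique up to a permutation. -/
theorem exists_perm_of_diagonal {n : ℕ} {A U U' : Matrix (Fin n) (Fin n) DQ}
    (hU : U ∈ unitary (Matrix (Fin n) (Fin n) DQ)) (hU' : U' ∈ unitary (Matrix (Fin n) (Fin n) DQ))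
    {d d' : Fin n → DualNumber ℝ} (hd : Uᴴ * A * U = Matrix.diagonal fun i => (d i : DQ))
    (hd' : U'ᴴ * A * U' = Matrix.diagonal fun i => (d' i : DQ)) :
    ∃ σ : Equiv.Perm (Fin n), ∀ j, d' (σ j) = d j := by
  have hV' := Unitary.mem_iff.1 (mul_mem (Unitary.star_mem hU') hU)
  have e := Matrix.conjTranspose_mul_intertwines hU hU' hd hd'
  rw [Matrix.star_eq_conjTranspose, Matrix.star_eq_conjTranspose] at hV'
  generalize U'ᴴ * U = V at hV' e
  -- Entrywise `e` reads `V i j * d j = d' i * V i j`; where `V i j` has nonzero standard part it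
  -- can be cancelled, the `d` being central.
  refine exists_perm_of_doubly_stochastic (a := fun i j => Quaternion.normSq (stdPart (V i j)))
    (sum_normSq_stdPart_col hV'.1) (fun i => ?_) fun i j h => ?_
  · have := sum_normSq_stdPart_col (U := Vᴴ)
      ((congrArg (· * Vᴴ) (Matrix.conjTranspose_conjTranspose V)).trans hV'.2) i
    simpa [stdPart_star] using this
  · have hu : IsUnit (V i j) := isUnit_iff_stdPart_ne_zero.2 (Quaternion.normSq_ne_zero.1 h)
    have := congrFun (congrFun e i) j
    rw [Matrix.mul_diagonal, Matrix.diagonal_mul, Quaternion.coe_commutes] at this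
    exact Quaternion.coe_injective (hu.mul_left_cancel this).symm

/-! ### Lexicographic order and systems of blocks -/

/-- The lexicographic order on dual numbers. -/
def LexGE (c d : DualNumber ℝ) : Prop := d.fst < c.fst ∨ c.fst = d.fst ∧ d.snd ≤ c.snd

theorem LexGE.antisymm {c d : DualNumber ℝ} (h : LexGE c d) (h' : LexGE d c) : c = d := by
  rcases h with h | ⟨h, h₁⟩ <;> rcases h' with h' | ⟨h', h₂⟩
  · exact absurd h h'.asymm
  · exact absurd h' h.ne
  · exact absurd h h'.ne
  · exact TrivSqZeroExt.ext h (le_antisymm h₂ h₁)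

theorem entries_cons (b : ℝ × List ℝ) (L : List (ℝ × List ℝ)) :
    entries (b :: L) = (b.2.map fun t => dual b.1 t) ++ entries L := rfl

theorem exists_mem_of_mem_entries {L : List (ℝ × List ℝ)} {c : DualNumber ℝ}
    (h : c ∈ entries L) : ∃ b ∈ L, c.fst = b.1 := by
  simp only [entries, List.mem_flatMap, List.mem_map] at h
  obtain ⟨b, hb, t, -, rfl⟩ := h
  exact ⟨b, hb, dual_fst _ _⟩

theorem Admissible.fst_pos_of_mem {L : List (ℝ × List ℝ)} (hL : Admissible L)
    {c : DualNumber ℝ} (h : c ∈ entries L) : 0 < c.fst := by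
  obtain ⟨b, hb, e⟩ := exists_mem_of_mem_entries h
  exact e ▸ hL.pos b hb

theorem Admissible.tail {b : ℝ × List ℝ} {L : List (ℝ × List ℝ)} (h : Admissible (b :: L)) :
    Admissible L :=
  ⟨(List.pairwise_cons.1 h.strictly_decreasing).2, fun c hc => h.pos c (List.mem_cons_of_mem _ hc),
    fun c hc => h.nonempty c (List.mem_cons_of_mem _ hc),
    fun c hc => h.decreasing c (List.mem_cons_of_mem _ hc)⟩

theorem Admissible.fst_lt_of_mem_tail {b : ℝ × List ℝ} {L : List (ℝ × List ℝ)}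
    (h : Admissible (b :: L)) {c : DualNumber ℝ} (hc : c ∈ entries L) : c.fst < b.1 := by
  obtain ⟨b', hb', e⟩ := exists_mem_of_mem_entries hc
  rw [e]
  exact (List.pairwise_cons.1 h.strictly_decreasing).1 _ (List.mem_map_of_mem hb')

theorem Admissible.pairwise_entries {L : List (ℝ × List ℝ)} (h : Admissible L) :
    (entries L).Pairwise LexGE := by
  induction L with
  | nil => exact List.Pairwise.nil
  | cons b L ih =>
    rw [entries_cons, List.pairwise_append]
    refine ⟨?_, ih h.tail, fun c hc d hd => ?_⟩
    · rw [List.pairwise_map]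
      exact (h.decreasing b List.mem_cons_self).imp fun {s t} hst =>
        Or.inr ⟨by simp, by simpa using hst⟩
    · obtain ⟨t, -, rfl⟩ := List.mem_map.1 hc
      exact Or.inl (by simpa using h.fst_lt_of_mem_tail hd)

/-- As blocks are nonempty, the first entry reveals `λ_1`; the entries with that standard part are
exactly the first block. Cancel it and induct. -/
theorem Admissible.eq_of_entries_eq {L L' : List (ℝ × List ℝ)} (h : Admissible L)
    (h' : Admissible L') (e : entries L = entries L') : L = L' := by
  have head : ∀ {b : ℝ × List ℝ} {M : List (ℝ × List ℝ)}, Admissible (b :: M) →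
      ∃ t l, entries (b :: M) = dual b.1 t :: l := by
    intro b M hM
    obtain ⟨t, l, hb⟩ := List.exists_cons_of_ne_nil (hM.nonempty b List.mem_cons_self)
    exact ⟨t, _, by rw [entries_cons, hb]; rfl⟩
  have filt : ∀ {b : ℝ × List ℝ} {M : List (ℝ × List ℝ)}, Admissible (b :: M) →
      ((entries (b :: M)).filter fun c => c.fst = b.1) = b.2.map fun t => dual b.1 t := by
    intro b M hM
    rw [entries_cons, List.filter_append, List.filter_eq_self.2, List.filter_eq_nil_iff.2,
      List.append_nil]
    · intro c hc
      simpa using (hM.fst_lt_of_mem_tail hc).ne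
    · intro c hc
      obtain ⟨t, -, rfl⟩ := List.mem_map.1 hc
      simp
  induction L generalizing L' with
  | nil =>
    cases L' with
    | nil => rfl
    | cons b M =>
      obtain ⟨t, l, hb⟩ := head h'
      rw [hb] at e
      cases e
  | cons b L ih =>
    cases L' with
    | nil =>
      obtain ⟨t, l, hb⟩ := head h
      rw [hb] at e
      cases e
    | cons b' L' =>
      have e₁ : b.1 = b'.1 := by
        obtain ⟨t, l, hb⟩ := head h
        obtain ⟨t', l', hb'⟩ := head h'
        rw [hb, hb', List.cons.injEq] at e
        simpa using congrArg TrivSqZeroExt.fst e.1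
      have e₂ : (b.2.map fun t => dual b.1 t) = b'.2.map fun t => dual b'.1 t := by
        rw [← filt h, ← filt h', e, e₁]
      have e₃ : b = b' := by
        refine Prod.ext e₁ ?_
        rw [e₁] at e₂
        refine List.map_injective_iff.2 (fun s t hst => ?_) e₂
        simpa using congrArg TrivSqZeroExt.snd hst
      rw [entries_cons, entries_cons, e₂, List.append_cancel_left_eq] at e
      rw [e₃, ih h.tail h'.tail e]

/-- A decreasing list of dual numbers, each zero or of positive standard part, lists the entries of
an admissible system, followed by zeros. -/
theorem exists_admissible {l : List (DualNumber ℝ)} (hl : l.Pairwise LexGE)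
    (hpos : ∀ c ∈ l, 0 < c.fst ∨ c = 0) :
    ∃ L k, Admissible L ∧ l = entries L ++ List.replicate k 0 := by
  induction l with
  | nil => exact ⟨[], 0, ⟨by simp, by simp, by simp, by simp⟩, rfl⟩
  | cons c l ih =>
    obtain ⟨hc, hl⟩ := List.pairwise_cons.1 hl
    rcases hpos c List.mem_cons_self with h0 | rfl
    · obtain ⟨L, k, hL, rfl⟩ := ih hl fun d hd => hpos d (List.mem_cons_of_mem _ hd)
      have hdual : dual c.fst c.snd = c := TrivSqZeroExt.ext (by simp) (by simp)
      have hge : ∀ b ∈ L, ∀ t ∈ b.2, LexGE c (dual b.1 t) := fun b hb t ht =>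
        hc _ (List.mem_append_left _ (List.mem_flatMap.2 ⟨b, hb, List.mem_map_of_mem ht⟩))
      have hle : ∀ b ∈ L, b.1 ≤ c.fst := by
        intro b hb
        obtain ⟨t, l', e⟩ := List.exists_cons_of_ne_nil (hL.nonempty b hb)
        rcases hge b hb t (by rw [e]; exact List.mem_cons_self) with h | h
        · exact (by simpa using h : b.1 < c.fst).le
        · exact (by simpa using h.1.symm : b.1 = c.fst).le
      -- Either `c` joins the first block or it opens a new one.
      by_cases hM : ∃ b M, L = b :: M ∧ b.1 = c.fst
      · obtain ⟨b, M, rfl, hb⟩ := hM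
        refine ⟨(b.1, c.snd :: b.2) :: M, k, ⟨hL.strictly_decreasing, ?_, ?_, ?_⟩, ?_⟩
        · exact List.forall_mem_cons.2 ⟨hb ▸ h0, hL.tail.pos⟩
        · exact List.forall_mem_cons.2 ⟨by simp, hL.tail.nonempty⟩
        · refine List.forall_mem_cons.2 ⟨List.pairwise_cons.2 ⟨fun t ht => ?_,
            hL.decreasing b List.mem_cons_self⟩, hL.tail.decreasing⟩
          rcases hge b List.mem_cons_self t ht with h | h
          · rw [dual_fst, hb] at h
            exact absurd h (lt_irrefl _)
          · simpa using h.2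
        · simp [entries_cons, hb, hdual]
      · have hlt : ∀ b ∈ L, b.1 < c.fst := by
          cases L with
          | nil => simp
          | cons b M =>
            have hb : b.1 < c.fst := lt_of_le_of_ne (hle b List.mem_cons_self) fun h =>
              hM ⟨b, M, rfl, h⟩
            refine List.forall_mem_cons.2 ⟨hb, fun b' hb' => lt_trans ?_ hb⟩
            exact (List.pairwise_cons.1 hL.strictly_decreasing).1 _ (List.mem_map_of_mem hb')
        refine ⟨(c.fst, [c.snd]) :: L, k, ⟨?_, ?_, ?_, ?_⟩, ?_⟩
        · refine List.pairwise_cons.2 ⟨fun a ha => ?_, hL.strictly_decreasing⟩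
          obtain ⟨b, hb, rfl⟩ := List.mem_map.1 ha
          exact hlt b hb
        · exact List.forall_mem_cons.2 ⟨h0, hL.pos⟩
        · exact List.forall_mem_cons.2 ⟨by simp, hL.nonempty⟩
        · exact List.forall_mem_cons.2 ⟨by simp, hL.decreasing⟩
        · simp [entries_cons, hdual]
    -- Once `0` occurs, no later entry can have positive standard part, so all are zero.
    · refine ⟨[], l.length + 1, ⟨by simp, by simp, by simp, by simp⟩, ?_⟩
      rw [List.replicate_succ]
      refine congrArg (List.cons 0) (List.eq_replicate_of_mem fun d hd => ?_)
      rcases hpos d (List.mem_cons_of_mem _ hd) with h | h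
      · rcases hc d hd with h' | h'
        · exact absurd h h'.asymm
        · exact absurd h'.1 h.ne
      · exact h

theorem ofFn_getD {α : Type*} (l : List α) (z : α) {n : ℕ} (h : l.length ≤ n) :
    List.ofFn (fun p : Fin n => l.getD p z) = l ++ List.replicate (n - l.length) z := by
  apply List.ext_getElem
  · simp; omega
  · intro i h₁ h₂
    simp only [List.getElem_ofFn, List.getD_eq_getElem?_getD, List.getElem_append]
    split_ifs with hi
    · simp [hi]
    · simp [List.getElem?_eq_none (not_lt.1 hi)]

theorem exists_sort_lexGE {n : ℕ} (d : Fin n → DualNumber ℝ) :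
    ∃ σ : Equiv.Perm (Fin n), (List.ofFn (d ∘ σ)).Pairwise LexGE := by
  -- The signs turn the increasing order of `Tuple.sort` into a decreasing one.
  let f : Fin n → ℝ ×ₗ ℝ := fun i => toLex (-(d i).fst, -(d i).snd)
  refine ⟨Tuple.sort f, ?_⟩
  rw [List.pairwise_ofFn]
  intro i j hij
  have := Tuple.monotone_sort f hij.le
  simpa [f, Prod.Lex.le_iff, LexGE] using this

end DualQuat

end

/-! ### Existence and uniqueness of the normal form -/

theorem theorem5p1 (m n : ℕ) (B : Matrix (Fin m) (Fin n) DualQuat.DQ) :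
    (∃! L : List (ℝ × List ℝ),
      DualQuat.Admissible L ∧ (DualQuat.entries L).length ≤ n ∧
        ∃ U ∈ unitary (Matrix (Fin n) (Fin n) DualQuat.DQ),
          Uᴴ * (Bᴴ * B) * U = DualQuat.diagForm n L) ∧
    (∀ c : DualNumber ℝ, DualQuat.IsEigenvalue (Bᴴ * B) c → c.fst = 0 → c = 0) := by
  refine ⟨?_, fun c hc h0 => hc.eq_zero h0⟩
  obtain ⟨U, hU, d, hd⟩ :=
    DualQuat.exists_unitary_diagonal (Matrix.isHermitian_conjTranspose_mul_self B)
  obtain ⟨σ, hσ⟩ := DualQuat.exists_sort_lexGE d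
  have hpos : ∀ c ∈ List.ofFn (d ∘ σ), 0 < c.fst ∨ c = 0 := by
    intro c hc
    obtain ⟨i, rfl⟩ := List.mem_ofFn.1 hc
    have hi := DualQuat.isEigenvalue_of_diagonal hU hd (σ i)
    exact hi.fst_nonneg.lt_or_eq.imp id fun h => hi.eq_zero h.symm
  obtain ⟨L, k, hL, hLk⟩ := DualQuat.exists_admissible hσ hpos
  have hlen : (DualQuat.entries L).length + k = n := by
    simpa using (congrArg List.length hLk).symm
  refine ⟨L, ⟨hL, by omega, ?_⟩, ?_⟩
  · obtain ⟨U', hU', hd'⟩ := Matrix.exists_unitary_diagonal_comp hU hd σ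
    refine ⟨U', hU', ?_⟩
    have e : (fun p : Fin n => (DualQuat.entries L).getD p 0) = d ∘ σ := by
      apply List.ofFn_injective
      rw [hLk, DualQuat.ofFn_getD _ _ (by omega), ← hlen, Nat.add_sub_cancel_left]
    rw [hd', DualQuat.diagForm]
    congr 1
    funext p
    exact congrArg _ (congrFun e p).symm
  · rintro L' ⟨hL', hn', U', hU', hd'⟩
    obtain ⟨τ, hτ⟩ := DualQuat.exists_perm_of_diagonal hU hU' hd hd'
    have hperm : (List.ofFn (d ∘ σ)).Perm
        (List.ofFn fun p : Fin n => (DualQuat.entries L').getD p 0) := by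
      refine (Equiv.Perm.ofFn_comp_perm σ d).trans ?_
      rw [← funext hτ]
      exact Equiv.Perm.ofFn_comp_perm τ fun p : Fin n => (DualQuat.entries L').getD p 0
    rw [hLk, DualQuat.ofFn_getD _ _ hn'] at hperm
    -- Keeping positive standard parts strips the padding, leaving two sorted lists that are
    -- permutations of each other, hence equal by antisymmetry.
    have hfilter : ∀ (M : List (ℝ × List ℝ)) (j : ℕ), DualQuat.Admissible M →
        ((DualQuat.entries M ++ List.replicate j 0).filter fun c => 0 < c.fst)
          = DualQuat.entries M := by
      intro M j hM
      rw [List.filter_append, List.filter_eq_self.2, List.filter_eq_nil_iff.2, List.append_nil]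
      · intro c hc
        simp [List.eq_of_mem_replicate hc]
      · intro c hc
        simpa using hM.fst_pos_of_mem hc
    have hp := hperm.filter fun c => 0 < c.fst
    rw [hfilter L _ hL, hfilter L' _ hL'] at hp
    exact hL'.eq_of_entries_eq hL (hp.symm.eq_of_pairwise (fun _ _ _ _ h h' => h.antisymm h')
      hL'.pairwise_entries hL.pairwise_entries)
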